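/- Let $\alpha$ be an algebraic number that is expanding, i.e. every complex root of its minimal polynomial has modulus $>1$. Let $K=\mathbb{Q}(\alpha)$, with ring of integers $\mathcal{O}$, and write $\alpha\mathcal{O}=\mathfrak{a}/\mathfrak{b}$ with coprime ideals $\mathfrak{a},\mathfrak{b}$ of $\mathcal{O}$. Let $$\mathbb{K}_\alpha=\prod_{\mathfrak{p}\mid\infty}K_{\mathfrak{p}}\times\prod_{\mathfrak{p}\mid\mathfrak{b}}K_{\mathfrak{p}}$$ with the product topology, where $K_{\mathfrak p}$ is the completion of $K$ at $\mathfrak p$, and let $\Phi_\alpha:K\to\mathbb{K}_\alpha$ be the diagonal embedding. Let $\mathcal{D}\subset\mathbb{Z}[\alpha]$ be a (finite) complete set of coset representatives of $\mathbb{Z}[\alpha]/\alpha\mathbb{Z}[\alpha]$, and let $\mathbb{Z}\langle\alpha,\mathcal{D}\rangle$ be the smallest $\alpha$-invariant $\mathbb{Z}$-submodule of $\mathbb{Z}[\alpha]$ that contains $\mathcal{D}-\mathcal{D}$. Let $\mathcal{F}\subset\mathbb{K}_\alpha$ be the rational self-affine tile, i.e. the unique non-empty compact set with $$\Phi_\alpha(\alpha)\,\mathcal{F}=\bigcup_{d\in\mathcal{D}}\big(\mathcal{F}+\Phi_\alpha(d)\big),$$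 and for $x\in\mathbb{Z}[\alpha]$ let $\mathcal{G}(x)=\{(z_{\mathfrak p})_{\mathfrak p}\in\mathcal{F}+\Phi_\alpha(x):\ z_{\mathfrak{p}}=0\text{ for every }\mathfrak{p}\mid\mathfrak{b}\}$ be the intersective tile at $x$. Then $$\mathcal{F}=\overline{\bigcup_{x\in\mathbb{Z}\langle\alpha,\mathcal{D}\rangle}\big(\mathcal{G}(x)-\Phi_\alpha(x)\big)}.$$ -/

import Mathlib

open scoped Pointwise nonZeroDivisors

open NumberField IsDedekindDomain

namespace RationalTile

noncomputable section

/-- An algebraic number is expanding if all complex roots of its minimal polynomial lie strictly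
outside the closed unit disc. -/
def IsExpanding {K : Type*} [Field K] [NumberField K] (α : K) : Prop :=
  ∀ z : ℂ, Polynomial.aeval z (minpoly ℚ α) = 0 → 1 < ‖z‖

/-- `α 𝓞 = 𝔞 / 𝔟` with coprime integral ideals `𝔞`, `𝔟`. -/
def IsReducedQuotient {K : Type*} [Field K] [NumberField K] (α : K) (𝔞 𝔟 : Ideal (𝓞 K)) : Prop :=
  IsCoprime 𝔞 𝔟 ∧
    FractionalIdeal.spanSingleton (𝓞 K)⁰ α
      = (𝔞 : FractionalIdeal (𝓞 K)⁰ K) / (𝔟 : FractionalIdeal (𝓞 K)⁰ K)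

/-- The finite primes of `K` dividing `𝔟`. -/
abbrev PrimesDividing {K : Type*} [Field K] [NumberField K] (𝔟 : Ideal (𝓞 K)) : Type _ :=
  {𝔭 : HeightOneSpectrum (𝓞 K) // 𝔭.asIdeal ∣ 𝔟}

/-- `K_∞ = ∏_{𝔭 ∣ ∞} K_𝔭`. -/
abbrev KInf (K : Type*) [Field K] [NumberField K] : Type _ :=
  (v : InfinitePlace K) → v.Completion

/-- `K_𝔟 = ∏_{𝔭 ∣ 𝔟} K_𝔭`. -/
abbrev KFin {K : Type*} [Field K] [NumberField K] (𝔟 : Ideal (𝓞 K)) : Type _ :=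
  (𝔭 : PrimesDividing 𝔟) → 𝔭.1.adicCompletion K

/-- The representation space `K_∞ × K_𝔟`, a topological ring with the product topology. -/
abbrev RepSpace {K : Type*} [Field K] [NumberField K] (𝔟 : Ideal (𝓞 K)) : Type _ :=
  KInf K × KFin 𝔟

/-- The diagonal embedding `Φ` of `K` into the representation space. -/
def Φ {K : Type*} [Field K] [NumberField K] (𝔟 : Ideal (𝓞 K)) : K →+* RepSpace 𝔟 :=
  algebraMap K (RepSpace 𝔟)

/-- The ring `ℤ[α]`. -/
abbrev ZAlpha {K : Type*} [Field K] [NumberField K] (α : K) : Subalgebra ℤ K :=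
  Algebra.adjoin ℤ {α}

/-- `D ⊆ ℤ[α]` is a complete set of representatives of `ℤ[α] / α ℤ[α]`. -/
def IsStandardDigitSet {K : Type*} [Field K] [NumberField K] (α : K) (D : Finset K) : Prop :=
  (∀ d ∈ D, d ∈ ZAlpha α) ∧
    ∀ x ∈ ZAlpha α, ∃! d, d ∈ D ∧ ∃ y ∈ ZAlpha α, x - d = α * y

/-- `ℤ⟨α, D⟩`, the smallest `α`-invariant `ℤ`-submodule of `ℤ[α]` containing `D - D`. -/
def digitModule {K : Type*} [Field K] [NumberField K] (α : K) (D : Finset K) : Submodule ℤ K :=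
  sInf {M : Submodule ℤ K | (∀ x ∈ M, x ∈ ZAlpha α) ∧ (∀ x ∈ M, α * x ∈ M) ∧
    ∀ d ∈ D, ∀ d' ∈ D, d - d' ∈ M}

/-- `F` is a non-empty compact solution of the set equation `α · F = ⋃_{d ∈ D} (F + Φ(d))`. -/
def IsTile {K : Type*} [Field K] [NumberField K] (α : K) (𝔟 : Ideal (𝓞 K)) (D : Finset K)
    (F : Set (RepSpace 𝔟)) : Prop :=
  F.Nonempty ∧ IsCompact F ∧
    (fun z => Φ 𝔟 α * z) '' F = ⋃ d ∈ D, (F + {Φ 𝔟 d})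

/-- The tile `F(α, D)`: the set that satisfies `IsTile`; it exists and is unique by
`existsUnique_isTile` below. -/
def tile {K : Type*} [Field K] [NumberField K] (α : K) (𝔟 : Ideal (𝓞 K)) (D : Finset K) :
    Set (RepSpace 𝔟) :=
  Classical.epsilon (IsTile α 𝔟 D)

/-- The intersective tile `G(x) = {z ∈ F + Φ(x) : z_𝔭 = 0 for all 𝔭 ∣ 𝔟}`. -/
def intersectiveTile {K : Type*} [Field K] [NumberField K] (α : K) (𝔟 : Ideal (𝓞 K))
    (D : Finset K) (x : K) : Set (RepSpace 𝔟) :=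
  {z | z ∈ tile α 𝔟 D + {Φ 𝔟 x} ∧ ∀ 𝔭 : PrimesDividing 𝔟, z.2 𝔭 = 0}

/-! The tile is well defined. -/

theorem IsExpanding.ne_zero {K : Type*} [Field K] [NumberField K] {α : K} (h : IsExpanding α) :
    α ≠ 0 := by
  rintro rfl
  have := h 0 (by simp [minpoly.zero])
  simp at this
  linarith

theorem IsExpanding.one_lt_norm {K : Type*} [Field K] [NumberField K] {α : K} (h : IsExpanding α)
    (v : InfinitePlace K) : 1 < ‖(algebraMap K v.Completion α)‖ := by
  rw [InfinitePlace.Completion.algebraMap_apply, InfinitePlace.Completion.norm_coe]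
  have h1 := h (v.embedding α) (by
    have := Polynomial.aeval_algHom_apply (v.embedding.toRatAlgHom) α (minpoly ℚ α)
    simpa using this)
  rw [← InfinitePlace.norm_embedding_eq]
  simpa using h1

theorem IsReducedQuotient.ne_bot {K : Type*} [Field K] [NumberField K] {α : K}
    {𝔞 𝔟 : Ideal (𝓞 K)} (h : IsReducedQuotient α 𝔞 𝔟) (hα : α ≠ 0) : 𝔟 ≠ ⊥ := by
  rintro rfl
  have := h.2
  simp at this
  exact hα (FractionalIdeal.spanSingleton_eq_zero_iff.mp this)

theorem IsReducedQuotient.one_lt_norm {K : Type*} [Field K] [NumberField K] {α : K}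
    {𝔞 𝔟 : Ideal (𝓞 K)} (h : IsReducedQuotient α 𝔞 𝔟) (hα : α ≠ 0) (𝔭 : PrimesDividing 𝔟) :
    1 < ‖(algebraMap K (𝔭.1.adicCompletion K) α)‖ := by
  obtain ⟨x, hx, hxp⟩ : ∃ x ∈ 𝔞, x ∉ 𝔭.1.asIdeal := by
    by_contra! hc
    apply 𝔭.1.isPrime.ne_top
    rw [eq_top_iff, ← Ideal.isCoprime_iff_sup_eq.mp h.1]
    exact sup_le hc (Ideal.le_of_dvd 𝔭.2)
  have hb : (𝔟 : FractionalIdeal (𝓞 K)⁰ K) ≠ 0 := by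
    simpa using h.ne_bot hα
  have h2 : (𝔞 : FractionalIdeal (𝓞 K)⁰ K)
      = FractionalIdeal.spanSingleton (𝓞 K)⁰ α * (𝔟 : FractionalIdeal (𝓞 K)⁰ K) := by
    rw [h.2, div_mul_cancel₀ _ hb]
  have h3 : (algebraMap (𝓞 K) K x) ∈ (𝔞 : FractionalIdeal (𝓞 K)⁰ K) :=
    FractionalIdeal.mem_coeIdeal_of_mem _ hx
  rw [h2, FractionalIdeal.mem_singleton_mul] at h3
  obtain ⟨y', hy', hxy⟩ := h3
  obtain ⟨y, hy, rfl⟩ := (FractionalIdeal.mem_coeIdeal _).mp hy'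
  have e1 := (FinitePlace.norm_eq_one_iff_notMem K 𝔭.1 x).mpr hxp
  have e2 := (FinitePlace.norm_lt_one_iff_mem K 𝔭.1 y).mpr (Ideal.le_of_dvd 𝔭.2 hy)
  rw [hxy, map_mul, norm_mul] at e1
  change 1 < ‖FinitePlace.embedding 𝔭.1 α‖
  by_contra! hc
  have := norm_nonneg (FinitePlace.embedding 𝔭.1 (algebraMap (𝓞 K) K y))
  nlinarith

theorem existsUnique_attractor {X ι : Type*} [NormedCommRing X] [CompleteSpace X] (a b : X)
    (hab : a * b = 1) (hb : ‖b‖ < 1) (D : Finset ι) (hD : D.Nonempty) (φ : ι → X) :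
    ∃! F : Set X, F.Nonempty ∧ IsCompact F ∧
      (fun z => a * z) '' F = ⋃ d ∈ D, (F + {φ d}) := by
  have hmem : ∀ F : Set X, (fun z => a * z) '' F = ⋃ d ∈ D, (F + {φ d}) →
      ∀ z, z ∈ F ↔ ∃ d ∈ D, ∃ y ∈ F, z = b * (y + φ d) := by
    intro F hF z
    have h1 : z ∈ F ↔ a * z ∈ (fun z => a * z) '' F := by
      constructor
      · exact fun h => ⟨z, h, rfl⟩
      · rintro ⟨w, hw, hwz⟩
        have : w = z := by
          have := congrArg (fun t => b * t) hwz
          simp only [← mul_assoc, mul_comm b a, hab, one_mul] at this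
          exact this
        exact this ▸ hw
    rw [h1, hF]
    simp only [Set.mem_iUnion, Set.add_singleton, Set.mem_image, exists_prop]
    refine exists_congr fun d => and_congr_right fun _ => exists_congr fun y =>
      and_congr_right fun _ => ⟨fun h => ?_, fun h => ?_⟩
    · rw [h, ← mul_assoc, mul_comm b a, hab, one_mul]
    · rw [h, ← mul_assoc, hab, one_mul]
  have hsub : ∀ F G : Set X, G.Nonempty → IsCompact F → IsCompact G →
      (fun z => a * z) '' F = ⋃ d ∈ D, (F + {φ d}) →
      (fun z => a * z) '' G = ⋃ d ∈ D, (G + {φ d}) → F ⊆ G := by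
    intro F G hGn hFc hGc hF hG x hx
    obtain ⟨C, hC⟩ := (hFc.isBounded.sub hGc.isBounded).exists_norm_le
    have key : ∀ n : ℕ, ∀ x ∈ F, ∃ y ∈ G, ‖x - y‖ ≤ ‖b‖ ^ n * C := by
      intro n
      induction n with
      | zero =>
        intro x hx
        obtain ⟨y, hy⟩ := hGn
        exact ⟨y, hy, by simpa using hC _ (Set.sub_mem_sub hx hy)⟩
      | succ n ih =>
        intro x hx
        obtain ⟨d, hd, x', hx', rfl⟩ := (hmem F hF x).mp hx
        obtain ⟨y', hy', hxy⟩ := ih x' hx'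
        refine ⟨b * (y' + φ d), (hmem G hG _).mpr ⟨d, hd, y', hy', rfl⟩, ?_⟩
        have : b * (x' + φ d) - b * (y' + φ d) = b * (x' - y') := by ring
        rw [this, pow_succ', mul_assoc]
        exact (norm_mul_le _ _).trans (by gcongr)
    choose y hy hxy using fun n => key n x hx
    have hlim : Filter.Tendsto y Filter.atTop (nhds x) := by
      rw [tendsto_iff_norm_sub_tendsto_zero]
      have h0 := (tendsto_pow_atTop_nhds_zero_of_lt_one (norm_nonneg b) hb).mul_const C
      rw [zero_mul] at h0
      exact squeeze_zero (fun _ => norm_nonneg _)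
        (fun n => by rw [norm_sub_rev]; exact hxy n) h0
    exact hGc.isClosed.mem_of_tendsto hlim (Filter.Eventually.of_forall hy)
  obtain ⟨d₀, hd₀⟩ := hD
  let _ : TopologicalSpace D := ⊥
  have : DiscreteTopology D := ⟨rfl⟩
  obtain ⟨C, hC⟩ := (D.finite_toSet.image φ).isBounded.exists_norm_le
  have hC' : ∀ d : D, ‖φ d‖ ≤ C := fun d => hC _ ⟨d, d.2, rfl⟩
  have hbound : ∀ (n : ℕ) (s : ℕ → D), ‖b ^ (n + 1) * φ (s n)‖ ≤ ‖b‖ ^ (n + 1) * C := fun n s =>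
    (norm_mul_le _ _).trans (mul_le_mul (norm_pow_le' _ n.succ_pos) (hC' _) (norm_nonneg _)
      (by positivity))
  have hsum : Summable fun n : ℕ => ‖b‖ ^ (n + 1) * C :=
    ((summable_nat_add_iff 1).mpr (summable_geometric_of_lt_one (norm_nonneg b) hb)).mul_right C
  let f : (ℕ → D) → X := fun s => ∑' n, b ^ (n + 1) * φ (s n)
  have hf : Continuous f :=
    continuous_tsum (fun n => continuous_const.mul
      ((continuous_of_discreteTopology (f := fun d : D => φ d)).comp (continuous_apply n)))
      hsum hbound
  have hrec : ∀ s : ℕ → D, f s = b * (f (fun n => s (n + 1)) + φ (s 0)) := by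
    intro s
    have hs : ∀ s : ℕ → D, Summable fun n => b ^ (n + 1) * φ (s n) := fun s =>
      Summable.of_norm_bounded hsum (fun n => hbound n s)
    change ∑' n, b ^ (n + 1) * φ (s n) = _
    rw [(hs s).tsum_eq_zero_add, mul_add, add_comm, ← (hs _).tsum_mul_left b]
    congr 1
    · exact tsum_congr fun n => by rw [pow_succ' b (n + 1), mul_assoc]
    · simp
  have : Nonempty (ℕ → D) := ⟨fun _ => ⟨d₀, hd₀⟩⟩
  have hFn : (Set.range f).Nonempty := Set.range_nonempty f
  have hFc : IsCompact (Set.range f) := isCompact_range hf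
  have hF : (fun z => a * z) '' Set.range f = ⋃ d ∈ D, (Set.range f + {φ d}) := by
    ext z
    simp only [Set.mem_iUnion, Set.add_singleton, Set.mem_image, Set.mem_range, exists_prop]
    constructor
    · rintro ⟨_, ⟨s, rfl⟩, rfl⟩
      refine ⟨s 0, (s 0).2, _, ⟨fun n => s (n + 1), rfl⟩, ?_⟩
      rw [hrec s, ← mul_assoc, hab, one_mul]
    · rintro ⟨d, hd, _, ⟨s, rfl⟩, rfl⟩
      refine ⟨_, ⟨fun n => Nat.casesOn n ⟨d, hd⟩ s, rfl⟩, ?_⟩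
      rw [hrec, ← mul_assoc, hab, one_mul]
      rfl
  exact ⟨Set.range f, ⟨hFn, hFc, hF⟩, fun G ⟨hGn, hGc, hG⟩ =>
    (hsub G _ hFn hGc hFc hG hF).antisymm (hsub _ G hGn hFc hGc hF hG)⟩

theorem existsUnique_isTile {K : Type*} [Field K] [NumberField K] {α : K} {𝔞 𝔟 : Ideal (𝓞 K)}
    {D : Finset K} (hα : IsExpanding α) (h : IsReducedQuotient α 𝔞 𝔟) (hD : D.Nonempty) :
    ∃! F, IsTile α 𝔟 D F := by
  have hfin : Finite (PrimesDividing 𝔟) := Ideal.finite_factors (h.ne_bot hα.ne_zero)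
  have := Fintype.ofFinite (PrimesDividing 𝔟)
  refine existsUnique_attractor (X := RepSpace 𝔟) (Φ 𝔟 α) (Φ 𝔟 α⁻¹) ?_ ?_ D hD (Φ 𝔟)
  · rw [← map_mul, mul_inv_cancel₀ hα.ne_zero, map_one]
  · rw [Prod.norm_def]
    refine max_lt ?_ ?_
    · refine (pi_norm_lt_iff one_pos).mpr fun v => ?_
      change ‖algebraMap K v.Completion α⁻¹‖ < 1
      rw [map_inv₀, norm_inv]
      exact inv_lt_one_of_one_lt₀ (hα.one_lt_norm v)
    · refine (pi_norm_lt_iff one_pos).mpr fun 𝔭 => ?_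
      change ‖algebraMap K (𝔭.1.adicCompletion K) α⁻¹‖ < 1
      rw [map_inv₀, norm_inv]
      exact inv_lt_one_of_one_lt₀ (h.one_lt_norm hα.ne_zero 𝔭)

theorem IsStandardDigitSet.nonempty {K : Type*} [Field K] [NumberField K] {α : K}
    {D : Finset K} (h : IsStandardDigitSet α D) : D.Nonempty := by
  obtain ⟨d, hd, -⟩ := h.2 0 (zero_mem _)
  exact ⟨d, hd.1⟩

theorem isTile_tile {K : Type*} [Field K] [NumberField K] {α : K} {𝔞 𝔟 : Ideal (𝓞 K)}
    {D : Finset K} (hα : IsExpanding α) (h : IsReducedQuotient α 𝔞 𝔟) (hD : D.Nonempty) :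
    IsTile α 𝔟 D (tile α 𝔟 D) :=
  Classical.epsilon_spec (existsUnique_isTile hα h hD).exists

end

end RationalTile

/-! Iterating the set equation `n` times writes a point of the tile `F` as `α⁻ⁿ(w + Φ(s))` with `w ∈
F`. Exchanging `w` for another point of `F` stays in `F` and moves the point by at most a constant
times `‖Φ(α⁻¹)ⁿ‖`, which tends to 0. A point of `F` with finite component `-x` lies in `G(x) -
Φ(x)`, so it suffices to find `w' ∈ F` with finite component `-(s + αⁿx)` for some `x ∈ ℤ⟨α, D⟩`. It
exists because `F` has an interior point (`IsTile.interior_nonempty`) and `αⁿℤ⟨α, D⟩` is dense in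
`K_𝔟` (`IsStandardDigitSet.exists_mem_digitModule_norm_lt`).

The interior comes from Baire's theorem: the countably many translates `F + Φ(x)`, `x ∈ ℤ[α]`, cover
the space, since `Φ(ℤ[α])` is relatively dense and meets every ball in finitely many points. Density
follows from approximation in `K_𝔟` by `ℤ[α]`, because `ℤ⟨α, D⟩` contains `(d - d')ℤ[α]` for two
distinct digits.

The reverse inclusion only needs `F` to be closed. -/

namespace RationalTile

noncomputable section

/-! ### Approximation by algebraic integers at finite places -/

theorem norm_add_le_max_adicCompletion {K : Type*} [Field K] [NumberField K]
    (v : HeightOneSpectrum (𝓞 K)) (a b : v.adicCompletion K) : ‖a + b‖ ≤ max ‖a‖ ‖b‖ := by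
  have hm := (WithZeroMulInt.toNNReal_strictMono
    (HeightOneSpectrum.one_lt_absNorm_nnreal v)).monotone
  simp only [FinitePlace.norm_def]
  norm_cast
  rw [← hm.map_max]
  exact hm (Valued.v.map_add a b)

theorem exists_forall_valuation_le_exp_norm_lt {K : Type*} [Field K] [NumberField K]
    (v : HeightOneSpectrum (𝓞 K)) {ε : ℝ} (hε : 0 < ε) :
    ∃ n : ℕ, ∀ x : K, v.valuation K x ≤ WithZero.exp (-(n : ℤ)) →
      ‖algebraMap K (v.adicCompletion K) x‖ < ε := by
  have h1 := HeightOneSpectrum.one_lt_absNorm_nnreal v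
  have hm := WithZeroMulInt.toNNReal_strictMono h1
  obtain ⟨n, hn⟩ := exists_pow_lt_of_lt_one hε (inv_lt_one_of_one_lt₀ (NNReal.coe_lt_coe.mpr h1))
  refine ⟨n, fun x hx => ?_⟩
  change ‖FinitePlace.embedding v x‖ < ε
  rw [FinitePlace.norm_embedding']
  refine lt_of_le_of_lt (NNReal.coe_le_coe.mpr (hm.monotone hx)) ?_
  rw [WithZeroMulInt.toNNReal_neg_apply _ WithZero.exp_ne_zero]
  have h : Multiplicative.toAdd (WithZero.unzero (WithZero.exp_ne_zero (a := -(n : ℤ)))) = -n := rfl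
  rw [h]
  simpa using hn

theorem valuation_le_one_of_norm_le_one {K : Type*} [Field K] [NumberField K]
    (v : HeightOneSpectrum (𝓞 K)) {x : K}
    (hx : ‖algebraMap K (v.adicCompletion K) x‖ ≤ 1) : v.valuation K x ≤ 1 := by
  have hm := WithZeroMulInt.toNNReal_strictMono (HeightOneSpectrum.one_lt_absNorm_nnreal v)
  change ‖FinitePlace.embedding v x‖ ≤ 1 at hx
  rw [FinitePlace.norm_embedding'] at hx
  rw [← hm.le_iff_le, map_one]
  exact_mod_cast hx

theorem exists_integer_norm_sub_lt {K : Type*} [Field K] [NumberField K]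
    (v : HeightOneSpectrum (𝓞 K)) (z : v.adicCompletion K) (hz : ‖z‖ ≤ 1) {ε : ℝ} (hε : 0 < ε) :
    ∃ r : 𝓞 K, ‖z - algebraMap K (v.adicCompletion K) (algebraMap (𝓞 K) K r)‖ < ε := by
  -- Precision below 1 forces `x` into the closed unit ball by the ultrametric inequality, so `x` is
  -- `v`-integral.
  obtain ⟨x, hx⟩ := (HeightOneSpectrum.denseRange_algebraMap (R := 𝓞 K) (K := K) v).exists_dist_lt z
    (lt_min hε one_pos)
  rw [dist_eq_norm] at hx
  have hx1 : ‖algebraMap K (v.adicCompletion K) x‖ ≤ 1 := by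
    have h := norm_add_le_max_adicCompletion v (algebraMap K (v.adicCompletion K) x - z) z
    rw [sub_add_cancel, norm_sub_rev] at h
    exact h.trans (max_le ((hx.trans_le (min_le_right _ _)).le) hz)
  obtain ⟨n, hn⟩ := exists_forall_valuation_le_exp_norm_lt v hε
  obtain ⟨r, hr⟩ := v.exists_valuation_sub_lt_of_integer
    (valuation_le_one_of_norm_le_one v hx1)
    (Units.mk0 (WithZero.exp (-(n : ℤ))) WithZero.exp_ne_zero)
  have h := hn _ hr.le
  rw [map_sub, norm_sub_rev] at h
  refine ⟨r, ?_⟩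
  have h2 := norm_add_le_max_adicCompletion v (z - algebraMap K (v.adicCompletion K) x)
    (algebraMap K (v.adicCompletion K) x
      - algebraMap K (v.adicCompletion K) (algebraMap (𝓞 K) K r))
  rw [sub_add_sub_cancel] at h2
  exact h2.trans_lt (max_lt (hx.trans_le (min_le_left _ _)) h)

/-- The Chinese remainder theorem glues the approximations at the single primes. -/
theorem exists_integer_forall_norm_sub_lt {K : Type*} [Field K] [NumberField K]
    {ι : Type*} [Finite ι] (v : ι → HeightOneSpectrum (𝓞 K)) (hv : Function.Injective v)
    (z : (i : ι) → (v i).adicCompletion K) (hz : ∀ i, ‖z i‖ ≤ 1) {ε : ℝ} (hε : 0 < ε) :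
    ∃ r : 𝓞 K, ∀ i, ‖z i - algebraMap K ((v i).adicCompletion K) (algebraMap (𝓞 K) K r)‖ < ε := by
  have := Fintype.ofFinite ι
  choose r hr using fun i => exists_integer_norm_sub_lt (v i) (z i) (hz i) hε
  choose n hn using fun i => exists_forall_valuation_le_exp_norm_lt (v i) hε
  obtain ⟨y, hy⟩ := IsDedekindDomain.exists_forall_sub_mem_ideal (s := Finset.univ)
    (fun i => (v i).asIdeal) n (fun i _ => (v i).prime)
    (fun i _ j _ hij h => hij (hv (HeightOneSpectrum.ext h))) (fun i => r i)
  refine ⟨y, fun i => ?_⟩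
  have h := hn i (algebraMap (𝓞 K) K (y - r i)) (by
    rw [HeightOneSpectrum.valuation_of_algebraMap, HeightOneSpectrum.intValuation_le_pow_iff_mem]
    exact hy i (Finset.mem_univ i))
  rw [map_sub, map_sub, norm_sub_rev] at h
  have h2 := norm_add_le_max_adicCompletion (v i) (z i - algebraMap K _ (algebraMap (𝓞 K) K (r i)))
    (algebraMap K ((v i).adicCompletion K) (algebraMap (𝓞 K) K (r i))
      - algebraMap K _ (algebraMap (𝓞 K) K y))
  rw [sub_add_sub_cancel] at h2
  exact h2.trans_lt (max_lt (hr i) h)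

/-! ### Comparison of `ℤ[α]` with `𝓞`, and rounding at infinite places -/

/-- Every element of `K = ℚ[α]` has a denominator relative to `ℤ[α]`; the product over a finite
integral basis serves all of `𝓞`. -/
theorem exists_natCast_mul_mem_zAlpha {K : Type*} [Field K] [NumberField K] {α : K}
    (hK : IntermediateField.adjoin ℚ {α} = ⊤) :
    ∃ c : ℕ, c ≠ 0 ∧ ∀ r : 𝓞 K, (c : K) * algebraMap (𝓞 K) K r ∈ ZAlpha α := by
  have key : ∀ x : K, ∃ c : ℕ, c ≠ 0 ∧ (c : K) * x ∈ ZAlpha α := by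
    intro x
    have hx : x ∈ Algebra.adjoin ℚ {α} := by
      rw [← IntermediateField.adjoin_toSubalgebra, hK]
      trivial
    induction hx using Algebra.adjoin_induction with
    | mem x hx => exact ⟨1, one_ne_zero, by simpa using Algebra.subset_adjoin hx⟩
    | algebraMap q =>
      refine ⟨q.den, q.den_ne_zero, ?_⟩
      have h : (q.den : K) * algebraMap ℚ K q = (q.num : K) := by
        rw [eq_ratCast, mul_comm]
        exact_mod_cast Rat.mul_den_eq_num q
      rw [h]
      exact intCast_mem _ _
    | add x y _ _ hx hy =>
      obtain ⟨c, hc, hcx⟩ := hx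
      obtain ⟨d, hd, hdy⟩ := hy
      refine ⟨c * d, mul_ne_zero hc hd, ?_⟩
      have h : ((c * d : ℕ) : K) * (x + y) = d * (c * x) + c * (d * y) := by push_cast; ring
      rw [h]
      exact add_mem (mul_mem (natCast_mem _ _) hcx) (mul_mem (natCast_mem _ _) hdy)
    | mul x y _ _ hx hy =>
      obtain ⟨c, hc, hcx⟩ := hx
      obtain ⟨d, hd, hdy⟩ := hy
      refine ⟨c * d, mul_ne_zero hc hd, ?_⟩
      have h : ((c * d : ℕ) : K) * (x * y) = (c * x) * (d * y) := by push_cast; ring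
      rw [h]
      exact mul_mem hcx hdy
  choose c hc hcm using key
  let b := RingOfIntegers.basis K
  refine ⟨∏ i, c (algebraMap (𝓞 K) K (b i)), Finset.prod_ne_zero_iff.mpr fun i _ => hc _,
    fun r => ?_⟩
  rw [← b.sum_repr r, map_sum, Finset.mul_sum]
  refine sum_mem fun i hi => ?_
  rw [← Finset.mul_prod_erase _ _ hi, zsmul_eq_mul, map_mul, map_intCast]
  have h (u m k x : K) : u * m * (k * x) = m * k * (u * x) := by ring
  push_cast
  rw [h]
  refine mul_mem (mul_mem (prod_mem fun j _ => natCast_mem _ _) (intCast_mem _ _)) (hcm _)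

theorem norm_algebraMap_completion {K : Type*} [Field K] (v : InfinitePlace K) (x : K) :
    ‖algebraMap K v.Completion x‖ = v x := by
  rw [InfinitePlace.Completion.algebraMap_apply, InfinitePlace.Completion.norm_coe]
  rfl

/-- Approximate by a point of `K`, then round its coordinates in the basis `c * b i` down. The
fractional parts are rationals in `[0, 1)`, so the error is at most `B`. -/
theorem exists_integer_infinite_norm_sub_le (K : Type*) [Field K] [NumberField K] (c : K)
    (hc : c ≠ 0) : ∃ R : ℝ, ∀ w : KInf K, ∃ r : 𝓞 K,
      ‖w - algebraMap K (KInf K) (c * algebraMap (𝓞 K) K r)‖ ≤ R := by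
  let b := integralBasis K
  let B := ∑ i, ‖algebraMap K (KInf K) (c * b i)‖
  refine ⟨B + 1, fun w => ?_⟩
  obtain ⟨x, hx⟩ := DenseRange.exists_dist_lt (f := algebraMap K (KInf K))
    (InfiniteAdeleRing.denseRange_algebraMap K) w one_pos
  rw [dist_eq_norm] at hx
  let q := b.repr (c⁻¹ * x)
  refine ⟨∑ i, ⌊q i⌋ • RingOfIntegers.basis K i, ?_⟩
  have hxq : x = ∑ i, (q i : K) * (c * b i) := by
    have h : ∑ i, q i • b i = c⁻¹ * x := b.sum_repr _
    simp_rw [Algebra.smul_def, eq_ratCast] at h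
    simp_rw [mul_left_comm _ c, ← Finset.mul_sum]
    rw [h, mul_inv_cancel_left₀ hc]
  have h1 : ‖algebraMap K (KInf K) (x - c * algebraMap (𝓞 K) K
      (∑ i, ⌊q i⌋ • RingOfIntegers.basis K i))‖ ≤ B := by
    have : x - c * algebraMap (𝓞 K) K (∑ i, ⌊q i⌋ • RingOfIntegers.basis K i)
        = ∑ i, ((Int.fract (q i) : ℚ) : K) * (c * b i) := by
      rw [hxq, map_sum, Finset.mul_sum, ← Finset.sum_sub_distrib]
      refine Finset.sum_congr rfl fun i _ => ?_
      rw [map_zsmul, ← integralBasis_apply, zsmul_eq_mul, ← Int.self_sub_floor]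
      push_cast
      ring
    rw [this, map_sum]
    refine (norm_sum_le _ _).trans (Finset.sum_le_sum fun i _ => ?_)
    rw [map_mul]
    refine (norm_mul_le _ _).trans (mul_le_of_le_one_left (norm_nonneg _) ?_)
    refine (pi_norm_le_iff_of_nonneg zero_le_one).mpr fun v => ?_
    change ‖algebraMap K v.Completion ((Int.fract (q i) : ℚ) : K)‖ ≤ 1
    rw [norm_algebraMap_completion, ← InfinitePlace.norm_embedding_eq, map_ratCast,
      Complex.norm_ratCast, abs_of_nonneg (by exact_mod_cast Int.fract_nonneg _)]
    exact_mod_cast (Int.fract_lt_one (q i)).le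
  calc _ ≤ _ := norm_sub_le_norm_sub_add_norm_sub _ (algebraMap K (KInf K) x) _
    _ ≤ _ := by
      rw [← map_sub, add_comm]
      exact add_le_add h1 hx.le

/-! ### `Φ(ℤ[α])` is relatively dense and locally finite -/

section Embedding

variable {K : Type*} [Field K] [NumberField K] {α : K} {𝔞 𝔟 : Ideal (𝓞 K)}

theorem IsReducedQuotient.finite_primesDividing (h : IsReducedQuotient α 𝔞 𝔟) (hα : α ≠ 0) :
    Finite (PrimesDividing 𝔟) :=
  Ideal.finite_factors (h.ne_bot hα)

theorem IsReducedQuotient.norm_finite_inv_lt_one [Fintype (PrimesDividing 𝔟)]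
    (h : IsReducedQuotient α 𝔞 𝔟) (hα : α ≠ 0) : ‖algebraMap K (KFin 𝔟) α⁻¹‖ < 1 := by
  refine (pi_norm_lt_iff one_pos).mpr fun 𝔭 => ?_
  change ‖algebraMap K (𝔭.1.adicCompletion K) α⁻¹‖ < 1
  rw [map_inv₀, norm_inv]
  exact inv_lt_one_of_one_lt₀ (h.one_lt_norm hα 𝔭)

theorem IsReducedQuotient.norm_Φ_inv_lt_one [Fintype (PrimesDividing 𝔟)]
    (h : IsReducedQuotient α 𝔞 𝔟) (hα : IsExpanding α) : ‖Φ 𝔟 α⁻¹‖ < 1 := by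
  refine max_lt ((pi_norm_lt_iff one_pos).mpr fun v => ?_) (h.norm_finite_inv_lt_one hα.ne_zero)
  change ‖algebraMap K v.Completion α⁻¹‖ < 1
  rw [map_inv₀, norm_inv]
  exact inv_lt_one_of_one_lt₀ (hα.one_lt_norm v)

/-- Since `α⁻¹` is small at each prime dividing `𝔟`, some `α⁻ⁿc⁻¹z` lies in the unit ball and is
approximated by an integer `r`; scaling back gives `αⁿcr`, which is in `ℤ[α]`. -/
theorem exists_mem_zAlpha_norm_finite_sub_lt [Fintype (PrimesDividing 𝔟)]
    (hK : IntermediateField.adjoin ℚ {α} = ⊤) (h : IsReducedQuotient α 𝔞 𝔟) (hα : α ≠ 0)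
    (z : KFin 𝔟) {ε : ℝ} (hε : 0 < ε) :
    ∃ x ∈ ZAlpha α, ‖z - algebraMap K (KFin 𝔟) x‖ < ε := by
  obtain ⟨c, hc, hcm⟩ := exists_natCast_mul_mem_zAlpha hK
  have hc' : (c : K) ≠ 0 := Nat.cast_ne_zero.mpr hc
  have hlim := (tendsto_pow_atTop_nhds_zero_of_norm_lt_one
    (h.norm_finite_inv_lt_one hα)).mul_const (algebraMap K (KFin 𝔟) (c : K)⁻¹ * z)
  rw [zero_mul] at hlim
  obtain ⟨n, hn⟩ := (hlim.norm.eventually_lt_const (by rw [norm_zero]; exact one_pos)).exists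
  obtain ⟨w, β, hβ, hw1, hβw⟩ : ∃ w β : KFin 𝔟, β = algebraMap K (KFin 𝔟) (α ^ n * c) ∧
      ‖w‖ < 1 ∧ β * w = z := by
    refine ⟨_, _, rfl, hn, ?_⟩
    rw [← map_pow, ← mul_assoc, ← mul_assoc, ← map_mul, ← map_mul]
    have : α ^ n * c * α⁻¹ ^ n * (c : K)⁻¹ = 1 := by
      rw [inv_pow, mul_right_comm, mul_inv_cancel_right₀ hc', mul_inv_cancel₀ (pow_ne_zero n hα)]
    rw [this, map_one, one_mul]
  -- The summand 1 covers `β = 0`, which occurs when no prime divides `𝔟`.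
  have hβ0 : 0 < ‖β‖ + 1 := by positivity
  have hδ := div_pos hε hβ0
  obtain ⟨r, hr⟩ := exists_integer_forall_norm_sub_lt (fun 𝔭 : PrimesDividing 𝔟 => 𝔭.1)
    Subtype.val_injective w (fun 𝔭 => (norm_le_pi_norm w 𝔭).trans hw1.le) hδ
  refine ⟨α ^ n * (c * algebraMap (𝓞 K) K r),
    mul_mem (pow_mem (Algebra.self_mem_adjoin_singleton ℤ α) n) (hcm r), ?_⟩
  have hr' : ‖w - algebraMap K (KFin 𝔟) (algebraMap (𝓞 K) K r)‖ ≤ ε / (‖β‖ + 1) :=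
    (pi_norm_le_iff_of_nonneg hδ.le).mpr fun 𝔭 => (hr 𝔭).le
  rw [← mul_assoc, map_mul, ← hβ, ← hβw, ← mul_sub]
  calc _ ≤ ‖β‖ * ‖w - algebraMap K (KFin 𝔟) (algebraMap (𝓞 K) K r)‖ := norm_mul_le _ _
    _ ≤ ‖β‖ * (ε / (‖β‖ + 1)) := mul_le_mul_of_nonneg_left hr' (norm_nonneg _)
    _ < (‖β‖ + 1) * (ε / (‖β‖ + 1)) := mul_lt_mul_of_pos_right (lt_add_one _) hδ
    _ = ε := mul_div_cancel₀ _ hβ0.ne'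

/-- Fix the finite component up to 1, then correct the infinite one by an element of `c𝓞`, which
changes the finite component by at most 1. -/
theorem exists_forall_norm_sub_Φ_le [Fintype (PrimesDividing 𝔟)]
    (hK : IntermediateField.adjoin ℚ {α} = ⊤) (h : IsReducedQuotient α 𝔞 𝔟) (hα : α ≠ 0) :
    ∃ R : ℝ, ∀ z : RepSpace 𝔟, ∃ x ∈ ZAlpha α, ‖z - Φ 𝔟 x‖ ≤ R := by
  obtain ⟨c, hc, hcm⟩ := exists_natCast_mul_mem_zAlpha hK
  obtain ⟨R, hR⟩ := exists_integer_infinite_norm_sub_le K c (Nat.cast_ne_zero.mpr hc)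
  refine ⟨max R 2, fun z => ?_⟩
  obtain ⟨x, hx, hxz⟩ := exists_mem_zAlpha_norm_finite_sub_lt hK h hα z.2 one_pos
  obtain ⟨r, hr⟩ := hR (z.1 - algebraMap K (KInf K) x)
  refine ⟨x + c * algebraMap (𝓞 K) K r, add_mem hx (hcm r), max_le_max ?_ ?_⟩
  · change ‖z.1 - algebraMap K (KInf K) (x + c * algebraMap (𝓞 K) K r)‖ ≤ R
    rwa [map_add, ← sub_sub]
  · change ‖z.2 - algebraMap K (KFin 𝔟) (x + c * algebraMap (𝓞 K) K r)‖ ≤ 2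
    rw [map_add, ← sub_sub]
    refine (norm_sub_le _ _).trans ?_
    have h1 : ‖algebraMap K (KFin 𝔟) (c * algebraMap (𝓞 K) K r)‖ ≤ 1 := by
      refine (pi_norm_le_iff_of_nonneg zero_le_one).mpr fun 𝔭 => ?_
      have := FinitePlace.norm_le_one K 𝔭.1 (c * r)
      rwa [map_mul, map_natCast] at this
    linarith

theorem IsReducedQuotient.valuation_le_one (h : IsReducedQuotient α 𝔞 𝔟) (hα : α ≠ 0)
    (v : HeightOneSpectrum (𝓞 K)) (hv : ¬ v.asIdeal ∣ 𝔟) : v.valuation K α ≤ 1 := by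
  obtain ⟨y, hy, hyv⟩ : ∃ y ∈ 𝔟, y ∉ v.asIdeal := by
    by_contra! hc
    exact hv (Ideal.dvd_iff_le.mpr hc)
  have hb : (𝔟 : FractionalIdeal (𝓞 K)⁰ K) ≠ 0 := by
    simpa using h.ne_bot hα
  have h2 : (𝔞 : FractionalIdeal (𝓞 K)⁰ K)
      = FractionalIdeal.spanSingleton (𝓞 K)⁰ α * (𝔟 : FractionalIdeal (𝓞 K)⁰ K) := by
    rw [h.2, div_mul_cancel₀ _ hb]
  have h3 : α * algebraMap (𝓞 K) K y ∈ (𝔞 : FractionalIdeal (𝓞 K)⁰ K) := by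
    rw [h2, FractionalIdeal.mem_singleton_mul]
    exact ⟨_, FractionalIdeal.mem_coeIdeal_of_mem _ hy, rfl⟩
  obtain ⟨a, -, ha⟩ := (FractionalIdeal.mem_coeIdeal _).mp h3
  have h4 := v.valuation_le_one (K := K) a
  change v.valuation K (algebraMap (𝓞 K) K a) ≤ 1 at h4
  rwa [ha, map_mul, (v.valuation_eq_one_iff_notMem (K := K)).mpr hyv, mul_one] at h4

theorem IsReducedQuotient.valuation_le_one_of_mem_zAlpha (h : IsReducedQuotient α 𝔞 𝔟)
    (hα : α ≠ 0) (v : HeightOneSpectrum (𝓞 K)) (hv : ¬ v.asIdeal ∣ 𝔟) {x : K}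
    (hx : x ∈ ZAlpha α) : v.valuation K x ≤ 1 := by
  induction hx using Algebra.adjoin_induction with
  | mem x hx => exact hx ▸ h.valuation_le_one hα v hv
  | algebraMap n =>
    have := v.valuation_le_one (K := K) (n : 𝓞 K)
    change v.valuation K (algebraMap (𝓞 K) K n) ≤ 1 at this
    rwa [map_intCast, ← eq_intCast (algebraMap ℤ K)] at this
  | add x y _ _ hx hy => exact (Valuation.map_add _ _ _).trans (max_le hx hy)
  | mul x y _ _ hx hy => rw [map_mul]; exact mul_le_one' hx hy

/-- A fixed multiplier `γ`, a power of an element of `𝔟`, makes all these `x` integral: the norm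
bound handles primes dividing `𝔟`, and `ℤ[α]` is integral at the others. Only finitely many
algebraic integers of `K` have bounded conjugates. -/
theorem IsReducedQuotient.finite_zAlpha_norm_le [Fintype (PrimesDividing 𝔟)]
    (h : IsReducedQuotient α 𝔞 𝔟) (hα : α ≠ 0) (R : ℝ) :
    {x : K | x ∈ ZAlpha α ∧ ‖Φ 𝔟 x‖ ≤ R}.Finite := by
  obtain ⟨β, hβ, hβ0⟩ := Submodule.exists_mem_ne_zero_of_ne_bot (h.ne_bot hα)
  have hβ0' : algebraMap (𝓞 K) K β ≠ 0 := by simpa using hβ0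
  have hβ1 : ‖algebraMap K (KFin 𝔟) (algebraMap (𝓞 K) K β)‖ < 1 :=
    (pi_norm_lt_iff one_pos).mpr fun 𝔭 =>
      (FinitePlace.norm_lt_one_iff_mem K 𝔭.1 β).mpr (Ideal.le_of_dvd 𝔭.2 hβ)
  have hlim := (tendsto_pow_atTop_nhds_zero_of_norm_lt_one hβ1).norm.mul_const R
  rw [norm_zero, zero_mul] at hlim
  obtain ⟨n, hn⟩ := (hlim.eventually_lt_const one_pos).exists
  set γ : K := algebraMap (𝓞 K) K β ^ n with hγ
  rw [← map_pow, ← hγ] at hn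
  have hγ0 : γ ≠ 0 := pow_ne_zero _ hβ0'
  have hfin := Embeddings.finite_of_norm_le K ℂ (‖algebraMap K (KInf K) γ‖ * R)
  refine (hfin.preimage (mul_right_injective₀ hγ0).injOn).subset ?_
  rintro x ⟨hx, hxR⟩
  have hx1 : ‖algebraMap K (KInf K) x‖ ≤ R := (le_max_left _ _).trans hxR
  have hx2 : ‖algebraMap K (KFin 𝔟) x‖ ≤ R := (le_max_right _ _).trans hxR
  constructor
  · have : γ * x ∈ (algebraMap (𝓞 K) K).range := by
      refine HeightOneSpectrum.mem_integers_of_valuation_le_one K _ fun v => ?_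
      by_cases hv : v.asIdeal ∣ 𝔟
      · refine valuation_le_one_of_norm_le_one v ?_
        refine (norm_le_pi_norm (algebraMap K (KFin 𝔟) (γ * x)) ⟨v, hv⟩).trans ?_
        rw [map_mul]
        refine (norm_mul_le _ _).trans (le_trans ?_ hn.le)
        gcongr
      · rw [map_mul, hγ, map_pow]
        exact mul_le_one' (pow_le_one' (v.valuation_le_one _) n)
          (h.valuation_le_one_of_mem_zAlpha hα v hv hx)
    obtain ⟨r, hr⟩ := this
    change IsIntegral ℤ (γ * x)
    exact hr ▸ r.isIntegral_coe
  · intro φ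
    have h1 := norm_algebraMap_completion (InfinitePlace.mk φ) (γ * x)
    rw [InfinitePlace.apply] at h1
    rw [← h1]
    refine (norm_le_pi_norm (algebraMap K (KInf K) (γ * x)) (InfinitePlace.mk φ)).trans ?_
    rw [map_mul]
    refine (norm_mul_le _ _).trans ?_
    gcongr

end Embedding

/-! ### Translates of the tile cover the space -/

section Cover

variable {K : Type*} [Field K] [NumberField K] {α : K} {𝔞 𝔟 : Ideal (𝓞 K)} {D : Finset K}
  {F : Set (RepSpace 𝔟)}

theorem Φ_inv_mul_Φ (hα : α ≠ 0) (z : RepSpace 𝔟) : Φ 𝔟 α⁻¹ * (Φ 𝔟 α * z) = z := by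
  rw [← mul_assoc, ← map_mul, inv_mul_cancel₀ hα, map_one, one_mul]

theorem IsTile.inv_mul_mem (hF : IsTile α 𝔟 D F) (hα : α ≠ 0) {z : RepSpace 𝔟} (hz : z ∈ F)
    {d : K} (hd : d ∈ D) : Φ 𝔟 α⁻¹ * (z + Φ 𝔟 d) ∈ F := by
  have h : z + Φ 𝔟 d ∈ (fun z => Φ 𝔟 α * z) '' F := by
    rw [hF.2.2]
    exact Set.mem_biUnion hd (Set.add_mem_add hz rfl)
  obtain ⟨w, hw, hwz⟩ := h
  rw [← hwz]
  simpa only [Φ_inv_mul_Φ hα] using hw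

theorem IsTile.exists_eq_inv_mul (hF : IsTile α 𝔟 D F) (hα : α ≠ 0) {z : RepSpace 𝔟}
    (hz : z ∈ F) : ∃ w ∈ F, ∃ d ∈ D, z = Φ 𝔟 α⁻¹ * (w + Φ 𝔟 d) := by
  have h : Φ 𝔟 α * z ∈ ⋃ d ∈ D, (F + {Φ 𝔟 d}) := hF.2.2 ▸ ⟨z, hz, rfl⟩
  simp only [Set.mem_iUnion, Set.add_singleton, Set.mem_image, exists_prop] at h
  obtain ⟨d, hd, w, hw, hwz⟩ := h
  exact ⟨w, hw, d, hd, by rw [hwz, Φ_inv_mul_Φ hα]⟩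

/-- The shift `s` records only the digits used, so the tail `w` can be replaced freely within `F`.
-/
theorem IsTile.exists_expansion (hF : IsTile α 𝔟 D F) (hα : α ≠ 0) (n : ℕ) :
    ∀ z ∈ F, ∃ w ∈ F, ∃ s : K, z = Φ 𝔟 α⁻¹ ^ n * (w + Φ 𝔟 s) ∧
      ∀ w' ∈ F, Φ 𝔟 α⁻¹ ^ n * (w' + Φ 𝔟 s) ∈ F := by
  induction n with
  | zero => exact fun z hz => ⟨z, hz, 0, by simp, by simp⟩
  | succ n ih =>
    intro z hz
    obtain ⟨y, hy, d, hd, rfl⟩ := hF.exists_eq_inv_mul hα hz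
    obtain ⟨w, hw, s, rfl, hs⟩ := ih y hy
    have key : ∀ w' : RepSpace 𝔟, Φ 𝔟 α⁻¹ ^ (n + 1) * (w' + Φ 𝔟 (s + α ^ n * d))
        = Φ 𝔟 α⁻¹ * (Φ 𝔟 α⁻¹ ^ n * (w' + Φ 𝔟 s) + Φ 𝔟 d) := by
      intro w'
      have h1 : Φ 𝔟 α⁻¹ ^ n * Φ 𝔟 α ^ n = 1 := by
        rw [← mul_pow, ← map_mul, inv_mul_cancel₀ hα, map_one, one_pow]
      rw [map_add, map_mul, map_pow]
      linear_combination Φ 𝔟 α⁻¹ * Φ 𝔟 d * h1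
    exact ⟨w, hw, s + α ^ n * d, (key w).symm, fun w' hw' =>
      key w' ▸ hF.inv_mul_mem hα (hs w' hw') hd⟩

/-- Write `x = d + αy`: the digit `d` is absorbed by the set equation and `y` is the new
translation. -/
theorem IsTile.inv_mul_mem_add_zAlpha (hF : IsTile α 𝔟 D F) (hα : α ≠ 0)
    (hD : IsStandardDigitSet α D) {z : RepSpace 𝔟}
    (hz : ∃ x ∈ ZAlpha α, z - Φ 𝔟 x ∈ F) : ∃ x ∈ ZAlpha α, Φ 𝔟 α⁻¹ * z - Φ 𝔟 x ∈ F := by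
  obtain ⟨x, hx, hxz⟩ := hz
  obtain ⟨d, ⟨hd, y, hy, hxy⟩, -⟩ := hD.2 x hx
  refine ⟨y, hy, ?_⟩
  have h := hF.inv_mul_mem hα hxz hd
  have h2 : Φ 𝔟 x = Φ 𝔟 d + Φ 𝔟 α * Φ 𝔟 y := by
    rw [← map_mul, ← map_add, ← hxy, add_sub_cancel]
  have h3 := Φ_inv_mul_Φ hα (Φ 𝔟 y)
  convert h using 1
  rw [h2]
  linear_combination h3

/-- The union of translates is stable under `α⁻¹`. Approximating `αⁿz` by it within a fixed distance
and contracting shows that it is dense; local finiteness makes it closed. -/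
theorem IsTile.exists_sub_mem [Fintype (PrimesDividing 𝔟)] (hF : IsTile α 𝔟 D F)
    (hK : IntermediateField.adjoin ℚ {α} = ⊤) (hα : IsExpanding α)
    (h : IsReducedQuotient α 𝔞 𝔟) (hD : IsStandardDigitSet α D) (z : RepSpace 𝔟) :
    ∃ x ∈ ZAlpha α, z - Φ 𝔟 x ∈ F := by
  have hα0 := hα.ne_zero
  obtain ⟨R, hR⟩ := exists_forall_norm_sub_Φ_le hK h hα0
  obtain ⟨f, hf⟩ := hF.1
  choose x hx hxR using fun n : ℕ => hR (Φ 𝔟 α ^ n * z - f)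
  let a : ℕ → RepSpace 𝔟 := fun n => Φ 𝔟 α⁻¹ ^ n * (f + Φ 𝔟 (x n))
  have ha : ∀ n, ∃ y ∈ ZAlpha α, a n - Φ 𝔟 y ∈ F := by
    intro n
    have : ∀ m : ℕ, ∃ y ∈ ZAlpha α, Φ 𝔟 α⁻¹ ^ m * (f + Φ 𝔟 (x n)) - Φ 𝔟 y ∈ F := by
      intro m
      induction m with
      | zero => exact ⟨x n, hx n, by simpa using hf⟩
      | succ m ih =>
        rw [pow_succ', mul_assoc]
        exact hF.inv_mul_mem_add_zAlpha hα0 hD ih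
    exact this n
  have hlim : Filter.Tendsto a Filter.atTop (nhds z) := by
    rw [tendsto_iff_norm_sub_tendsto_zero]
    have h0 := (tendsto_pow_atTop_nhds_zero_of_norm_lt_one
      (h.norm_Φ_inv_lt_one hα)).norm.mul_const R
    rw [norm_zero, zero_mul] at h0
    refine squeeze_zero (fun _ => norm_nonneg _) (fun n => ?_) h0
    have h1 : a n - z = - (Φ 𝔟 α⁻¹ ^ n * (Φ 𝔟 α ^ n * z - f - Φ 𝔟 (x n))) := by
      have h1 : Φ 𝔟 α⁻¹ ^ n * Φ 𝔟 α ^ n = 1 := by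
        rw [← mul_pow, ← map_mul, inv_mul_cancel₀ hα0, map_one, one_pow]
      change Φ 𝔟 α⁻¹ ^ n * (f + Φ 𝔟 (x n)) - z = _
      linear_combination z * h1
    rw [h1, norm_neg]
    exact (norm_mul_le _ _).trans (mul_le_mul_of_nonneg_left (hxR n) (norm_nonneg _))
  obtain ⟨C, hC⟩ := hF.2.1.isBounded.exists_norm_le
  -- Only these translates can contain a point of norm below `‖z‖ + 1`, as `C` bounds `F`.
  let Y := {y : K | y ∈ ZAlpha α ∧ ‖Φ 𝔟 y‖ ≤ ‖z‖ + 1 + C}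
  have hY : Y.Finite := h.finite_zAlpha_norm_le hα0 _
  have hclosed : IsClosed (⋃ y ∈ Y, (fun w => w - Φ 𝔟 y) ⁻¹' F) :=
    hY.isClosed_biUnion fun y _ => hF.2.1.isClosed.preimage (continuous_id.sub continuous_const)
  have hmem : z ∈ ⋃ y ∈ Y, (fun w => w - Φ 𝔟 y) ⁻¹' F := by
    refine hclosed.mem_of_tendsto hlim ?_
    have hev := hlim.norm.eventually_lt_const (lt_add_one ‖z‖)
    filter_upwards [hev] with n hn
    obtain ⟨y, hy, hyF⟩ := ha n
    refine Set.mem_biUnion ⟨hy, ?_⟩ hyF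
    have h1 : Φ 𝔟 y = a n - (a n - Φ 𝔟 y) := (sub_sub_cancel _ _).symm
    rw [h1]
    exact (norm_sub_le _ _).trans (add_le_add hn.le (hC _ hyF))
  simp only [Set.mem_iUnion, exists_prop] at hmem
  obtain ⟨y, hy, hyz⟩ := hmem
  exact ⟨y, hy.1, hyz⟩

theorem IsTile.interior_nonempty [Fintype (PrimesDividing 𝔟)] (hF : IsTile α 𝔟 D F)
    (hK : IntermediateField.adjoin ℚ {α} = ⊤) (hα : IsExpanding α)
    (h : IsReducedQuotient α 𝔞 𝔟) (hD : IsStandardDigitSet α D) : (interior F).Nonempty := by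
  have : Countable K := (Module.finBasis ℚ K).equivFun.injective.countable
  obtain ⟨x, z, hz⟩ := nonempty_interior_of_iUnion_of_closed
    (f := fun x : ZAlpha α => (fun w => w - Φ 𝔟 (x : K)) ⁻¹' F)
    (fun x => hF.2.1.isClosed.preimage (continuous_id.sub continuous_const))
    (Set.eq_univ_of_forall fun z => by
      obtain ⟨x, hx, hxz⟩ := hF.exists_sub_mem hK hα h hD z
      exact Set.mem_iUnion.mpr ⟨⟨x, hx⟩, hxz⟩)
  refine ⟨z - Φ 𝔟 (x : K), ?_⟩
  have := (Homeomorph.subRight (Φ 𝔟 (x : K))).preimage_interior F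
  change z ∈ Homeomorph.subRight (Φ 𝔟 (x : K)) ⁻¹' interior F
  rw [this]
  exact hz

end Cover

/-! ### Density of the digit module at the finite places -/

section DigitModule

variable {K : Type*} [Field K] [NumberField K] {α : K} {𝔞 𝔟 : Ideal (𝓞 K)} {D : Finset K}

/-- With a single digit, `α` would be invertible in `ℤ[α]`, and the powers of `α⁻¹` would be
infinitely many elements of `ℤ[α]` in a bounded set. -/
theorem IsStandardDigitSet.nontrivial [Fintype (PrimesDividing 𝔟)] (hD : IsStandardDigitSet α D)
    (hα : IsExpanding α) (h : IsReducedQuotient α 𝔞 𝔟) : ∃ d ∈ D, ∃ d' ∈ D, d - d' ≠ 0 := by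
  by_contra! hc
  have hα0 := hα.ne_zero
  have hdiv : ∀ x ∈ ZAlpha α, α⁻¹ * x ∈ ZAlpha α := by
    intro x hx
    obtain ⟨d, ⟨hd, y, hy, hxy⟩, -⟩ := hD.2 x hx
    -- The digit need not be 0; representing 0 shows that it is a multiple of `α`.
    obtain ⟨e, ⟨he, w, hw, hew⟩, -⟩ := hD.2 0 (zero_mem _)
    have hde := hc d hd e he
    have : α⁻¹ * x = y - w := by
      rw [inv_mul_eq_iff_eq_mul₀ hα0]
      linear_combination hxy - hew + hde
    rw [this]
    exact sub_mem hy hw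
  have hpow : ∀ n : ℕ, α⁻¹ ^ n ∈ ZAlpha α := by
    intro n
    induction n with
    | zero => simp
    | succ n ih => rw [pow_succ']; exact hdiv _ ih
  -- An infinite place, where `α⁻¹` has absolute value in `(0, 1)`, separates its powers.
  obtain ⟨v⟩ : Nonempty (InfinitePlace K) := inferInstance
  have hv := hα.one_lt_norm v
  rw [norm_algebraMap_completion] at hv
  have hv0 : 0 < v α⁻¹ := by rw [map_inv₀]; positivity
  have hv1 : v α⁻¹ < 1 := by rw [map_inv₀]; exact inv_lt_one_of_one_lt₀ hv
  refine Set.infinite_of_injective_forall_mem (f := fun n : ℕ => α⁻¹ ^ (n + 1)) ?_ ?_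
    (h.finite_zAlpha_norm_le hα0 1)
  · intro m n hmn
    have h1 : v (α⁻¹ ^ (m + 1)) = v (α⁻¹ ^ (n + 1)) := congrArg v hmn
    rw [map_pow, map_pow] at h1
    exact Nat.succ_injective (pow_right_injective₀ hv0 hv1.ne h1)
  · intro n
    refine ⟨hpow _, ?_⟩
    rw [map_pow]
    exact (norm_pow_le' _ n.succ_pos).trans
      (pow_le_one₀ (norm_nonneg _) (h.norm_Φ_inv_lt_one hα).le)

theorem sub_mul_mem_digitModule {d d' x : K} (hd : d ∈ D) (hd' : d' ∈ D) (hx : x ∈ ZAlpha α) :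
    x * (d - d') ∈ digitModule α D := by
  refine Submodule.mem_sInf.mpr ?_
  rintro M ⟨-, hM, hMD⟩
  suffices ∀ m ∈ M, x * m ∈ M from this _ (hMD d hd d' hd')
  induction hx using Algebra.adjoin_induction with
  | mem x hx => exact hx ▸ hM
  | algebraMap n =>
    intro m hm
    rw [← Algebra.smul_def]
    exact M.smul_mem n hm
  | add x y _ _ hx hy => exact fun m hm => add_mul x y m ▸ add_mem (hx m hm) (hy m hm)
  | mul x y _ _ hx hy => exact fun m hm => (mul_assoc x y m).symm ▸ hx _ (hy m hm)

/-- Multiplication by `β ≠ 0` is a homeomorphism of `K_𝔟`, so it preserves density. -/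
theorem exists_mem_zAlpha_norm_finite_sub_mul_lt [Fintype (PrimesDividing 𝔟)]
    (hK : IntermediateField.adjoin ℚ {α} = ⊤) (h : IsReducedQuotient α 𝔞 𝔟) (hα : α ≠ 0)
    {β : K} (hβ : β ≠ 0) (z : KFin 𝔟) {ε : ℝ} (hε : 0 < ε) :
    ∃ x ∈ ZAlpha α, ‖z - algebraMap K (KFin 𝔟) (β * x)‖ < ε := by
  have hb : 0 < ‖algebraMap K (KFin 𝔟) β‖ + 1 := by positivity
  obtain ⟨x, hx, hxz⟩ := exists_mem_zAlpha_norm_finite_sub_lt hK h hα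
    (algebraMap K (KFin 𝔟) β⁻¹ * z) (div_pos hε hb)
  refine ⟨x, hx, ?_⟩
  have h1 : z - algebraMap K (KFin 𝔟) (β * x) = algebraMap K (KFin 𝔟) β *
      (algebraMap K (KFin 𝔟) β⁻¹ * z - algebraMap K (KFin 𝔟) x) := by
    rw [mul_sub, ← mul_assoc, ← map_mul, ← map_mul, mul_inv_cancel₀ hβ, map_one, one_mul]
  rw [h1]
  calc _ ≤ _ := norm_mul_le _ _
    _ ≤ ‖algebraMap K (KFin 𝔟) β‖ * (ε / (‖algebraMap K (KFin 𝔟) β‖ + 1)) :=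
      mul_le_mul_of_nonneg_left hxz.le (norm_nonneg _)
    _ < (‖algebraMap K (KFin 𝔟) β‖ + 1) * (ε / (‖algebraMap K (KFin 𝔟) β‖ + 1)) :=
      mul_lt_mul_of_pos_right (lt_add_one _) (div_pos hε hb)
    _ = ε := mul_div_cancel₀ _ hb.ne'

theorem IsStandardDigitSet.exists_mem_digitModule_norm_lt [Fintype (PrimesDividing 𝔟)]
    (hD : IsStandardDigitSet α D) (hK : IntermediateField.adjoin ℚ {α} = ⊤) (hα : IsExpanding α)
    (h : IsReducedQuotient α 𝔞 𝔟) (n : ℕ) (z : KFin 𝔟) {ε : ℝ} (hε : 0 < ε) :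
    ∃ x ∈ digitModule α D, ‖z - algebraMap K (KFin 𝔟) (α ^ n * x)‖ < ε := by
  obtain ⟨d, hd, d', hd', hdd⟩ := hD.nontrivial hα h
  obtain ⟨x, hx, hxz⟩ := exists_mem_zAlpha_norm_finite_sub_mul_lt hK h hα.ne_zero
    (mul_ne_zero (pow_ne_zero n hα.ne_zero) hdd) z hε
  refine ⟨x * (d - d'), sub_mul_mem_digitModule hd hd' hx, ?_⟩
  rwa [mul_comm x, ← mul_assoc]

end DigitModule

end

end RationalTile

/-! ### The density argument -/

theorem mainTheorem7 {K : Type*} [Field K] [NumberField K] (α : K)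
    (hK : IntermediateField.adjoin ℚ {α} = ⊤)
    (hα : RationalTile.IsExpanding α)
    (𝔞 𝔟 : Ideal (𝓞 K)) (h𝔟 : RationalTile.IsReducedQuotient α 𝔞 𝔟)
    (D : Finset K) (hD : RationalTile.IsStandardDigitSet α D) :
    RationalTile.tile α 𝔟 D =
      closure (⋃ x ∈ RationalTile.digitModule α D,
        (RationalTile.intersectiveTile α 𝔟 D x - {RationalTile.Φ 𝔟 x})) := by
  open RationalTile in
  have hα0 := hα.ne_zero
  have := h𝔟.finite_primesDividing hα0
  have := Fintype.ofFinite (PrimesDividing 𝔟)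
  have hF := isTile_tile hα h𝔟 hD.nonempty
  refine Set.Subset.antisymm (fun z hz => ?_) (closure_minimal ?_ hF.2.1.isClosed)
  · obtain ⟨u, hu⟩ := hF.interior_nonempty hK hα h𝔟 hD
    obtain ⟨δ, hδ, hball⟩ := Metric.mem_nhds_iff.mp (mem_interior_iff_mem_nhds.mp hu)
    obtain ⟨C, hC⟩ := hF.2.1.isBounded.exists_norm_le
    rw [Metric.mem_closure_iff]
    intro ε hε
    have hlim := (tendsto_pow_atTop_nhds_zero_of_norm_lt_one
      (h𝔟.norm_Φ_inv_lt_one hα)).norm.mul_const (C + C)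
    rw [norm_zero, zero_mul] at hlim
    obtain ⟨n, hn⟩ := (hlim.eventually_lt_const hε).exists
    obtain ⟨w, hw, s, rfl, hs⟩ := hF.exists_expansion hα0 n z hz
    -- The target makes `-(s + αⁿx)` lie within `δ` of the finite component of the interior point
    -- `u`.
    obtain ⟨x, hx, hxu⟩ := hD.exists_mem_digitModule_norm_lt hK hα h𝔟 n
      (-(u.2 + algebraMap K (KFin 𝔟) s)) hδ
    -- The finite component is chosen so that `α⁻ⁿ(w' + Φ(s))` has finite component exactly `-x`.
    let w' : RepSpace 𝔟 := (u.1, -algebraMap K (KFin 𝔟) (s + α ^ n * x))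
    have hw' : w' ∈ tile α 𝔟 D := by
      apply hball
      rw [mem_ball_iff_norm]
      refine max_lt ?_ ?_
      · change ‖u.1 - u.1‖ < δ
        rwa [sub_self, norm_zero]
      · change ‖-algebraMap K (KFin 𝔟) (s + α ^ n * x) - u.2‖ < δ
        rw [map_add]
        convert hxu using 2
        ring
    refine ⟨Φ 𝔟 α⁻¹ ^ n * (w' + Φ 𝔟 s), ?_, ?_⟩
    · refine Set.mem_biUnion hx ⟨_, ⟨Set.add_mem_add (hs w' hw') rfl, fun 𝔭 => ?_⟩, _, rfl,
        add_sub_cancel_right _ _⟩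
      change (algebraMap K (KFin 𝔟) α⁻¹ ^ n * (-algebraMap K (KFin 𝔟) (s + α ^ n * x)
        + algebraMap K (KFin 𝔟) s) + algebraMap K (KFin 𝔟) x) 𝔭 = 0
      rw [← map_pow, ← map_neg, ← map_add, ← map_mul, ← map_add]
      have : α⁻¹ ^ n * (-(s + α ^ n * x) + s) + x = 0 := by
        have h1 : α⁻¹ ^ n * α ^ n = 1 := by rw [← mul_pow, inv_mul_cancel₀ hα0, one_pow]
        linear_combination -x * h1
      rw [this, map_zero]
      rfl
    · rw [dist_eq_norm, ← mul_sub, add_sub_add_right_eq_sub]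
      refine ((norm_mul_le _ _).trans (mul_le_mul_of_nonneg_left ?_ (norm_nonneg _))).trans_lt hn
      exact (norm_sub_le _ _).trans (add_le_add (hC _ hw) (hC _ hw'))
  · refine Set.iUnion₂_subset fun x _ => ?_
    rintro _ ⟨g, ⟨⟨f, hf, _, rfl, rfl⟩, -⟩, _, rfl, rfl⟩
    simpa using hf
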